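/- Let $\mathcal F$ be a germ of holomorphic foliation on $(\mathbb C^2,0)$, given by a $1$-form $\omega=P\,dx+Q\,dy$ with $P,Q\in\mathbb C\{x,y\}$ coprime. Let $\pi=\pi_1\circ\cdots\circ\pi_n:(M,E)\to(\mathbb C^2,0)$, $n\ge 1$, be a (not necessarily minimal) reduction of singularities of $\mathcal F$, where $\pi_k$ is the blow-up of a point $p_{k-1}$ over $0$ ($p_0=0$) and $E_1,\dots,E_n$ are the components of $E$ (with $E_k$ created by $\pi_k$). That is: all singularities on $E$ of $\bar{\mathcal F}=\pi^*\mathcal F$ are reduced, $\bar{\mathcal F}$ is everywhere transverse to each non-invariant component of $E$, and two non-invariant components do not meet. Let $\bar{\mathcal F}_j=(\pi_1\circ\cdots\circ\pi_j)^*\mathcal F$. The proximity matrix $F$ is the $n\times n$ lower triangular matrix with $1$'s on the diagonal and, for $j<k$, $F_{kj}=-1$ if $p_{k-1}$ lies on (the strict transform of) $E_j$ and $F_{kj}=0$ otherwise. The weights are $\rho_{E_1}=1$ and $\rho_{E_k}=\sum\rho_{E_i}$ over the (one or two) components $E_i$, $i<k$, through $p_{k-1}$. Let $TSN$ be the set of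 tangent saddle-nodes, i.e. the saddle-nodes of $\bar{\mathcal F}$ on $E$ whose weak separatrix is contained in $E$, and let $\mu_q(\bar{\mathcal F},E_i)$ be the multiplicity of $\bar{\mathcal F}$ along $E_i$ at $q$: the order of vanishing at $q$ of the restriction to $E_i$ of a vector field defining $\bar{\mathcal F}$ with isolated singularities. Put $$T_{\mathcal F}=\Big(\sum_{q\in TSN\cap E_i}(\mu_q(\bar{\mathcal F},E_i)-1)\Big)_{i=1,\dots,n},\qquad \tau_0(\mathcal F)=\sum_{q\in TSN}\ \sum_{E_i\ni q}\rho_{E_i}\,(\mu_q(\bar{\mathcal F},E_i)-1),$$ and $\tau_{\mathcal F}=(\tau_0(\mathcal F),\tau_{p_1}(\bar{\mathcal F}_1),\dots,\tau_{p_{n-1}}(\bar{\mathcal F}_{n-1}))^{\mathsf T}$, where $\tau_{p_j}(\bar{\mathcal F}_j)$ is defined in the same way for the germ of $\bar{\mathcal F}_j$ at $p_j$ and the sub-reduction $\pi^{(j)}$ formed by those blow-ups of $\pi$ whose centres are $p_j$ or are infinitely near to $p_j$. Then each $\pi^{(j)}$ is a reduction of singularities of the germ of $\bar{\mathcal F}_j$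 at $p_j$, the sets of tangent saddle-nodes of $\pi$ and of all the $\pi^{(j)}$ are finite, $F$ is invertible over $\mathbb Z$, and $$(F^{-1})^{\mathsf T}\,T_{\mathcal F}=\tau_{\mathcal F}.$$ Moreover the first column of $F^{-1}$ is the vector of weights $(\rho_{E_1},\dots,\rho_{E_n})^{\mathsf T}$. More generally, for $0\le j\le n-1$, the entry of column $j+1$ of $F^{-1}$ in row $i$ is the weight of $E_i$ with respect to $\pi^{(j)}$ if $E_i$ is one of the components of $\pi^{(j)}$ (i.e. $E_i$ is contracted to $p_j$), and $0$ otherwise. -/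

import Mathlib

open scoped Matrix

noncomputable section

namespace PlaneFoliation

/-! ### Germs of foliations and formal `1`-forms in two variables -/

/-- Formal power series in the two coordinates `x = X 0` and `y = X 1`. -/
abbrev Series : Type := MvPowerSeries (Fin 2) ℂ

/-- A power series is convergent if its coefficients grow at most geometrically. -/
def Convergent (f : Series) : Prop :=
  ∃ C M : ℝ, ∀ m : Fin 2 →₀ ℕ, ‖MvPowerSeries.coeff m f‖ ≤ C * M ^ (m 0 + m 1)

/-- The (formal) `1`-form `P dx + Q dy`. -/
@[ext]
structure OneForm where
  P : Series
  Q : Series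

namespace OneForm

/-- `ω = P dx + Q dy` defines a germ of holomorphic foliation on `(ℂ², 0)`: the coefficients are
convergent, and they are coprime in the ring of convergent power series. -/
def DefinesFoliation (ω : OneForm) : Prop :=
  Convergent ω.P ∧ Convergent ω.Q ∧
    ∀ d a b : Series, Convergent d → Convergent a → Convergent b →
      ω.P = d * a → ω.Q = d * b → IsUnit d

/-- The components of the dual vector field `υ = -Q ∂/∂x + P ∂/∂y`. -/
def vectorField (ω : OneForm) : Fin 2 → Series := ![-ω.Q, ω.P]

/-- The origin is a singular point of `ω`. -/
def Singular (ω : OneForm) : Prop :=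
  MvPowerSeries.constantCoeff ω.P = 0 ∧ MvPowerSeries.constantCoeff ω.Q = 0

/-- The linear part `Dυ(0)` of the dual vector field. -/
def linearPart (ω : OneForm) : Matrix (Fin 2) (Fin 2) ℂ :=
  Matrix.of fun i j => MvPowerSeries.constantCoeff (MvPowerSeries.pderiv ℂ j (ω.vectorField i))

/-- Non-degenerate reduced singularity: the eigenvalues of the linear part are nonzero and their
quotient is not a positive rational number. -/
def IsNondegenerate (ω : OneForm) : Prop :=
  ω.Singular ∧ ∃ l₁ l₂ : ℂ, ω.linearPart.charpoly.roots = {l₁, l₂} ∧ l₁ ≠ 0 ∧ l₂ ≠ 0 ∧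
    ¬ ∃ r : ℚ, 0 < r ∧ l₁ / l₂ = (r : ℂ)

/-- Saddle-node: exactly one of the two eigenvalues of the linear part is zero. -/
def IsSaddleNode (ω : OneForm) : Prop :=
  ω.Singular ∧ ∃ l : ℂ, ω.linearPart.charpoly.roots = {l, 0} ∧ l ≠ 0

/-- Reduced singularity. -/
def IsReduced (ω : OneForm) : Prop := ω.IsNondegenerate ∨ ω.IsSaddleNode

/-- The coefficient of `dx ∧ dy` in `df ∧ ω`. -/
def wedge (f : Series) (ω : OneForm) : Series :=
  MvPowerSeries.pderiv ℂ 0 f * ω.Q - MvPowerSeries.pderiv ℂ 1 f * ω.P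

/-- The (formal) irreducible curve `{f = 0}` is a separatrix: `f` divides `df ∧ ω`. -/
def IsSeparatrix (ω : OneForm) (f : Series) : Prop :=
  Irreducible f ∧ f ∣ wedge f ω

/-- The differential `df(0)` applied to a vector. -/
def differential (f : Series) (v : Fin 2 → ℂ) : ℂ :=
  ∑ j, MvPowerSeries.constantCoeff (MvPowerSeries.pderiv ℂ j f) * v j

/-- `{f = 0}` is the weak separatrix of a saddle-node: the smooth (formal) separatrix tangent to
the eigenspace of the eigenvalue zero. -/
def IsWeakSeparatrix (ω : OneForm) (f : Series) : Prop :=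
  ω.IsSaddleNode ∧ ω.IsSeparatrix f ∧ differential f ≠ 0 ∧
    ∃ v : Fin 2 → ℂ, v ≠ 0 ∧ ω.linearPart *ᵥ v = 0 ∧ differential f v = 0

/-- `ω` is regular at the origin and transverse there to the smooth curve `{f = 0}`. -/
def IsTransverse (ω : OneForm) (f : Series) : Prop :=
  MvPowerSeries.constantCoeff (wedge f ω) ≠ 0

/-- The multiplicity of `ω` along a separatrix with primitive parametrization `γ`: the order of
the vector field `θ(t)` such that `γ_* θ = υ ∘ γ`. -/
def multiplicityAlong (ω : OneForm) (γ : Fin 2 → PowerSeries ℂ) : ℕ :=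
  sInf {m : ℕ | ∃ θ : PowerSeries ℂ,
    (∀ i, PowerSeries.derivative ℂ (γ i) * θ = MvPowerSeries.subst γ (ω.vectorField i)) ∧
    θ.order = (m : ℕ∞)}

/-- Coefficients of `f / (X a) ^ m`, for `f` divisible by `(X a) ^ m`. -/
def divXPow (a : Fin 2) (m : ℕ) (f : Series) : Series :=
  fun n => MvPowerSeries.coeff (n + Finsupp.single a m) f

/-- The largest power of `X a` dividing the `1`-form. -/
def orderAlong (a : Fin 2) (ω : OneForm) : ℕ :=
  (min (emultiplicity (MvPowerSeries.X a) ω.P) (emultiplicity (MvPowerSeries.X a) ω.Q)).toNat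

/-- Division of the `1`-form by the largest possible power of `X a`. -/
def saturate (a : Fin 2) (ω : OneForm) : OneForm where
  P := divXPow a (orderAlong a ω) ω.P
  Q := divXPow a (orderAlong a ω) ω.Q

/-- Pull-back of the `1`-form under the map `(x, y) = (φ 0, φ 1)`. -/
def pullback (φ : Fin 2 → Series) (ω : OneForm) : OneForm where
  P := MvPowerSeries.subst φ ω.P * MvPowerSeries.pderiv ℂ 0 (φ 0) +
    MvPowerSeries.subst φ ω.Q * MvPowerSeries.pderiv ℂ 0 (φ 1)
  Q := MvPowerSeries.subst φ ω.P * MvPowerSeries.pderiv ℂ 1 (φ 0) +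
    MvPowerSeries.subst φ ω.Q * MvPowerSeries.pderiv ℂ 1 (φ 1)

end OneForm

/-! ### Blow-ups -/

/-- A point of the exceptional line of the blow-up of a point with local coordinates `(x, y)`:
the direction `y = c x`, or the direction `x = 0`. -/
inductive Direction where
  | slope (c : ℂ)
  | vertical

/-- The blow-up map in the local coordinates centred at a point of the exceptional line:
`(x, t) ↦ (x, x (t + c))` at the direction `y = c x`, and `(s, y) ↦ (s y, y)` at the
direction `x = 0`. -/
def Direction.chart : Direction → Fin 2 → Series
  | slope c => ![MvPowerSeries.X 0, MvPowerSeries.X 0 * (MvPowerSeries.X 1 + MvPowerSeries.C c)]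
  | vertical => ![MvPowerSeries.X 0 * MvPowerSeries.X 1, MvPowerSeries.X 1]

/-- The coordinate whose zero set is the exceptional line, in the coordinates of
`Direction.chart`. -/
def Direction.excAxis : Direction → Fin 2
  | slope _ => 0
  | vertical => 1

/-- A point infinitely near to (or equal to) `0 ∈ ℂ²`: the list of directions that have to be
followed in successive blow-ups to reach it, the last one at the head. So `[]` is `0`, and
`d :: p` is the point `d` of the exceptional line of the blow-up of `p`; the same list
represents the same point in all blow-ups whose centres avoid it.
Each such point comes with the local coordinates given by `Direction.chart`. -/
abbrev Point : Type := List Direction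

/-- The germ at `q` of the pull-back foliation. -/
def transform (ω : OneForm) : Point → OneForm
  | [] => ω
  | d :: p => OneForm.saturate d.excAxis (OneForm.pullback d.chart (transform ω p))

/-- The exceptional divisor at the point `q`, in the local coordinates of `q`: `axis q a = some p`
means that `{X a = 0}` is the germ at `q` of (the strict transform of) the exceptional component
created by the blow-up of `p`, and `axis q a = none` that `{X a = 0}` is not exceptional.
In a blow-up one axis is the new component; the other axis is the strict transform of
`{y = 0}` at the direction of slope `0`, the strict transform of `{x = 0}` at the vertical
direction, and is not exceptional at the other directions. -/
def axis : Point → Fin 2 → Option Point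
  | [] => ![none, none]
  | Direction.slope c :: p =>
      open scoped Classical in ![some p, if c = 0 then axis p 1 else none]
  | Direction.vertical :: p => ![axis p 0, some p]

/-- The exceptional component created by the blow-up of `p` passes through `q`. -/
def OnComponent (p q : Point) : Prop := ∃ a, axis q a = some p

open scoped Classical in
/-- The coordinate axis that is the exceptional component of `p` at one of its points `q`. -/
def componentAxis (p q : Point) : Fin 2 := if axis q 0 = some p then 0 else 1

/-- Local equation at `q` of the exceptional component of `p`, for `q` on this component. -/
def componentEq (p q : Point) : Series := MvPowerSeries.X (componentAxis p q)

/-- The parametrization `t ↦ (0, t)` or `t ↦ (t, 0)` of `componentEq p q = 0`. -/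
def componentParam (p q : Point) : Fin 2 → PowerSeries ℂ :=
  fun a => if a = componentAxis p q then 0 else PowerSeries.X

/-- The fibre over `0` of the composition of the blow-ups with set of centres `C`: the points
that are not blown up themselves and that are `0` or lie on the exceptional line of a
centre. -/
def fibre (C : Set Point) : Set Point := {q | q ∉ C ∧ ∀ d p, q = d :: p → p ∈ C}

/-- A finite composition of point blow-ups over `(ℂ², 0)`, indexed by a finite linear order: each
centre is a point of the fibre over `0` of the composition of the preceding blow-ups
(so the first centre is `0`). -/
structure BlowUps (ι : Type) [LinearOrder ι] [Fintype ι] where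
  center : ι → Point
  center_mem : ∀ k, center k ∈ fibre (center '' {j | j < k})

/-- The point `q`, infinitely near to `p`, as a point infinitely near to the origin of the
coordinates of `p`. -/
def relative (p q : Point) : Point := q.take (q.length - p.length)

theorem relative_append {p q : Point} (h : p <:+ q) : relative p q ++ p = q := by
  obtain ⟨r, rfl⟩ := h
  simp [relative]

namespace BlowUps

variable {ι : Type} [LinearOrder ι] [Fintype ι] (π : BlowUps ι)

/-- The set `E` of points over `0` after all the blow-ups. -/
def points : Set Point := fibre (Set.range π.center)

instance (j : ι) : Fintype {k : ι // π.center j <:+ π.center k} := Fintype.ofFinite _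

/-- The sub-composition formed by the blow-ups whose centre is `center j` or is infinitely near
to it, as a composition of blow-ups over the origin of the local coordinates of `center j`. -/
def sub (j : ι) : BlowUps {k : ι // π.center j <:+ π.center k} where
  center k := relative (π.center j) (π.center k.1)
  center_mem := by
    rintro ⟨k, hk⟩
    obtain ⟨h₁, h₂⟩ := π.center_mem k
    have hk' := relative_append hk
    refine ⟨?_, ?_⟩
    · rintro ⟨⟨l, hl⟩, hlk, heq⟩
      refine h₁ ⟨l, hlk, ?_⟩
      rw [← hk', ← relative_append hl]
      exact congrArg (· ++ π.center j) heq
    · intro d r hr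
      have hr' : relative (π.center j) (π.center k) = d :: r := hr
      rw [hr'] at hk'
      obtain ⟨l, hlk, hl⟩ := h₂ d (r ++ π.center j) hk'.symm
      refine ⟨⟨l, ⟨r, hl.symm⟩⟩, hlk, ?_⟩
      change relative (π.center j) (π.center l) = r
      rw [hl]
      simp [relative]

open scoped Classical in
/-- The weights of the exceptional components: `1` for the first blow-up, and for the others the
sum of the weights of the (one or two) preceding components through the centre. -/
def weight (k : ι) : ℕ :=
  if π.center k = [] then 1
  else ∑ i : {i : ι // i < k}, if OnComponent (π.center i.1) (π.center k) then weight i.1 else 0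
termination_by wellFounded_lt.wrap k
decreasing_by exact i.2

open scoped Classical in
/-- The proximity matrix `F`: lower triangular with `1` on the diagonal, and with the entry `-1` at
`(k, j)`, `j < k`, if the `k`-th centre lies on the `j`-th component. -/
def proximity : Matrix ι ι ℤ :=
  Matrix.of fun k j =>
    if k = j then 1
    else if j < k ∧ OnComponent (π.center j) (π.center k) then -1 else 0

/-- `π` is a reduction of singularities of `ω`: all singularities of the pull-back foliation on `E`
are reduced; it is everywhere transverse to the non-invariant (dicritical) components of `E`; and
two dicritical components do not meet. -/
def IsReduction (ω : OneForm) : Prop :=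
  ∀ q ∈ π.points,
    ((transform ω q).Singular → (transform ω q).IsReduced) ∧
    (∀ i, OnComponent (π.center i) q →
      (transform ω q).IsSeparatrix (componentEq (π.center i) q) ∨
      (transform ω q).IsTransverse (componentEq (π.center i) q)) ∧
    (∀ i j, i ≠ j → OnComponent (π.center i) q → OnComponent (π.center j) q →
      (transform ω q).IsSeparatrix (componentEq (π.center i) q) ∨
      (transform ω q).IsSeparatrix (componentEq (π.center j) q))

/-- The tangent saddle-nodes: the saddle-nodes of the pull-back foliation on `E` whose weak
separatrix is contained in `E`. -/
def tangentSaddleNodes (ω : OneForm) : Set Point :=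
  {q | q ∈ π.points ∧ (transform ω q).IsSaddleNode ∧
    ∃ i, OnComponent (π.center i) q ∧
      (transform ω q).IsWeakSeparatrix (componentEq (π.center i) q)}

/-- The multiplicity at `q` of the pull-back foliation along the component of index `i`. -/
def componentMultiplicity (ω : OneForm) (q : Point) (i : ι) : ℕ :=
  (transform ω q).multiplicityAlong (componentParam (π.center i) q)

/-- The tangency saddle-node vector `T`. -/
def saddleNodeVector (ω : OneForm) (i : ι) : ℤ :=
  ∑ᶠ q ∈ π.tangentSaddleNodes ω ∩ {q | OnComponent (π.center i) q},
    ((π.componentMultiplicity ω q i : ℤ) - 1)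

open scoped Classical in
/-- The tangency excess at the origin. -/
def tangencyExcess (ω : OneForm) : ℤ :=
  ∑ᶠ q ∈ π.tangentSaddleNodes ω,
    ∑ i, if OnComponent (π.center i) q then
      (π.weight i : ℤ) * ((π.componentMultiplicity ω q i : ℤ) - 1) else 0

/-- The tangency excess vector: the tangency excesses, at the successive centres, of the
pull-back foliation there. -/
def tangencyExcessVector (ω : OneForm) (j : ι) : ℤ :=
  (π.sub j).tangencyExcess (transform ω (π.center j))

end BlowUps

end PlaneFoliation

end

noncomputable section

namespace PlaneFoliation

/-! ### The exceptional axes at infinitely near points -/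

/-! Two independent facts combine. Combinatorially, the recursion defining the weights is `F w =
e_j` with the off-diagonal terms moved to the right. The weights of `π.sub j`, extended by zero,
solve it, so they form column `j` of the inverse of `F` (`proximity_inv_apply_eq_dite`).
Geometrically, interchanging the sums over points and components gives the tangency excess as the
weighted sum of the entries of `T` (`tangencyExcess_eq_sum`). Applied to `π.sub j`, this gives the
identity once `T` for `π.sub j` is known to be the restriction of `T` for `π`
(`sub_saddleNodeVector`). The delicate case is a saddle-node over `center j` whose weak separatrix
lies in an older component: it is tangent for `π` but possibly not for `π.sub j`. There any other
component through the point is the strong separatrix, has multiplicity `1`, and contributes zero.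
The interchange needs finiteness: along an exceptional line the saturated pull-back has polynomial
coefficients, not both zero, so it has finitely many singular points. -/

theorem transform_append (ω : OneForm) (r p : Point) :
    transform ω (r ++ p) = transform (transform ω p) r := by
  induction r with
  | nil => rfl
  | cons d r ih => simp only [List.cons_append, transform, ih]

theorem suffix_of_axis_eq {p q : Point} {a : Fin 2} (h : axis q a = some p) :
    p <:+ q ∧ p.length < q.length := by
  induction q generalizing a with
  | nil => fin_cases a <;> simp [axis] at h
  | cons d r ih =>
    have key : ∀ b, axis r b = some p → p <:+ d :: r ∧ p.length < (d :: r).length := fun b hb =>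
      ⟨(ih hb).1.trans (List.suffix_cons d r), (ih hb).2.trans (by simp)⟩
    have self : r = p → p <:+ d :: r ∧ p.length < (d :: r).length := by
      rintro rfl
      exact ⟨List.suffix_cons d r, by simp⟩
    cases d with
    | slope c =>
      fin_cases a
      · exact self (by simpa [axis] using h)
      · by_cases hc : c = 0
        · exact key 1 (by simpa [axis, hc] using h)
        · simp [axis, hc] at h
    | vertical =>
      fin_cases a
      · exact key 0 (by simpa [axis] using h)
      · exact self (by simpa [axis] using h)

/-- Both sides follow the same recursion above `p`. At `p` itself every exceptional axis comes from
a strictly shorter point, so none has the form `s ++ p`. -/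
theorem axis_append_eq_iff {r s p : Point} {a : Fin 2} :
    axis (r ++ p) a = some (s ++ p) ↔ axis r a = some s := by
  induction r generalizing a with
  | nil =>
    constructor
    · intro h
      have := (suffix_of_axis_eq h).2
      simp at this
    · intro h
      fin_cases a <;> simp [axis] at h
  | cons d r ih =>
    cases d with
    | slope c =>
      fin_cases a
      · simp [axis]
      · by_cases hc : c = 0
        · simpa [axis, hc] using ih
        · simp [axis, hc]
    | vertical =>
      fin_cases a
      · simpa [axis] using ih
      · simp [axis]

theorem OnComponent.suffix {p q : Point} (h : OnComponent p q) : p <:+ q :=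
  (suffix_of_axis_eq h.choose_spec).1

theorem OnComponent.length_lt {p q : Point} (h : OnComponent p q) : p.length < q.length :=
  (suffix_of_axis_eq h.choose_spec).2

theorem onComponent_append_iff {r s p : Point} :
    OnComponent (s ++ p) (r ++ p) ↔ OnComponent s r := by
  simp only [OnComponent, axis_append_eq_iff]

theorem componentAxis_append (r s p : Point) :
    componentAxis (s ++ p) (r ++ p) = componentAxis s r := by
  by_cases h : axis r 0 = some s
  · rw [componentAxis, componentAxis, if_pos h, if_pos (axis_append_eq_iff.2 h)]
  · rw [componentAxis, componentAxis, if_neg h, if_neg (mt axis_append_eq_iff.1 h)]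

theorem componentEq_append (r s p : Point) : componentEq (s ++ p) (r ++ p) = componentEq s r := by
  rw [componentEq, componentEq, componentAxis_append]

theorem componentParam_append (r s p : Point) :
    componentParam (s ++ p) (r ++ p) = componentParam s r := by
  unfold componentParam
  rw [componentAxis_append]

theorem axis_componentAxis {p q : Point} (h : OnComponent p q) :
    axis q (componentAxis p q) = some p := by
  obtain ⟨a, ha⟩ := h
  unfold componentAxis
  split_ifs with h0
  · exact h0
  · fin_cases a
    · exact absurd ha h0
    · exact ha

/-! ### Sub-compositions -/

namespace BlowUps

variable {ι : Type} [LinearOrder ι] [Fintype ι] (π : BlowUps ι)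

theorem center_injective : Function.Injective π.center := by
  have key : ∀ i j, i < j → π.center i ≠ π.center j := fun i j hij h =>
    (π.center_mem j).1 ⟨i, hij, h⟩
  intro i j h
  rcases lt_trichotomy i j with hij | hij | hij
  · exact absurd h (key i j hij)
  · exact hij
  · exact absurd h.symm (key j i hij)

theorem sub_center_append (j : ι) (k : {k : ι // π.center j <:+ π.center k}) :
    (π.sub j).center k ++ π.center j = π.center k :=
  relative_append k.2

theorem sub_center_eq_nil_iff (j : ι) (k : {k : ι // π.center j <:+ π.center k}) :
    (π.sub j).center k = [] ↔ k.1 = j := by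
  rw [← π.center_injective.eq_iff, ← π.sub_center_append j k]
  simp

theorem sub_onComponent_iff (j : ι) (k : {k : ι // π.center j <:+ π.center k}) (r : Point) :
    OnComponent ((π.sub j).center k) r ↔ OnComponent (π.center k) (r ++ π.center j) := by
  rw [← π.sub_center_append j k, onComponent_append_iff]

theorem sub_componentEq (j : ι) (k : {k : ι // π.center j <:+ π.center k}) (r : Point) :
    componentEq ((π.sub j).center k) r = componentEq (π.center k) (r ++ π.center j) := by
  rw [← π.sub_center_append j k, componentEq_append]

theorem sub_componentMultiplicity (ω : OneForm) (j : ι)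
    (k : {k : ι // π.center j <:+ π.center k}) (r : Point) :
    (π.sub j).componentMultiplicity (transform ω (π.center j)) r k =
      π.componentMultiplicity ω (r ++ π.center j) k := by
  rw [componentMultiplicity, componentMultiplicity, transform_append, ← π.sub_center_append j k,
    componentParam_append]

theorem mem_range_sub_center_iff (j : ι) (r : Point) :
    r ∈ Set.range (π.sub j).center ↔ r ++ π.center j ∈ Set.range π.center := by
  constructor
  · rintro ⟨k, rfl⟩
    exact ⟨k, (π.sub_center_append j k).symm⟩
  · rintro ⟨k, hk⟩
    refine ⟨⟨k, r, hk.symm⟩, List.append_cancel_right (bs := π.center j) ?_⟩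
    rw [π.sub_center_append, hk]

theorem mem_sub_points_iff (j : ι) (r : Point) :
    r ∈ (π.sub j).points ↔ r ++ π.center j ∈ π.points := by
  unfold points fibre
  simp only [Set.mem_ofPred_eq, mem_range_sub_center_iff]
  refine and_congr_right fun hr => ?_
  cases r with
  -- The empty point satisfies the second fibre condition vacuously only on the left; it is excluded
  -- because `center j` is itself blown up.
  | nil => exact absurd ⟨j, rfl⟩ hr
  | cons d r => exact ⟨by rintro h _ _ ⟨⟩; exact h d r rfl, by rintro h _ _ ⟨⟩; exact h d _ rfl⟩

theorem IsReduction.sub {π : BlowUps ι} {ω : OneForm} (h : π.IsReduction ω) (j : ι) :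
    (π.sub j).IsReduction (transform ω (π.center j)) := by
  intro r hr
  obtain ⟨h₁, h₂, h₃⟩ := h _ ((π.mem_sub_points_iff j r).1 hr)
  rw [transform_append] at h₁ h₂ h₃
  refine ⟨h₁, fun i hi => ?_, fun i k hik hi hk => ?_⟩
  · rw [sub_componentEq]
    exact h₂ i ((π.sub_onComponent_iff j i r).1 hi)
  · rw [sub_componentEq, sub_componentEq]
    exact h₃ i k (fun h => hik (Subtype.ext h)) ((π.sub_onComponent_iff j i r).1 hi)
      ((π.sub_onComponent_iff j k r).1 hk)

/-! ### Weights and the inverse of the proximity matrix -/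

open scoped Classical in
-- No component passes through the origin, so the sum is empty for the centre `[]` and a single
-- formula covers both cases of the definition.
theorem weight_eq (k : ι) :
    (π.weight k : ℤ) = (if π.center k = [] then 1 else 0) +
      ∑ i, if i < k ∧ OnComponent (π.center i) (π.center k) then (π.weight i : ℤ) else 0 := by
  have hsum : ∑ i : {i : ι // i < k}, (if OnComponent (π.center i.1) (π.center k) then
      (π.weight i.1 : ℤ) else 0) =
      ∑ i, if i < k ∧ OnComponent (π.center i) (π.center k) then (π.weight i : ℤ) else 0 := by
    rw [← Finset.sum_subtype (Finset.univ.filter (· < k)) (by simp)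
      (fun i => if OnComponent (π.center i) (π.center k) then (π.weight i : ℤ) else 0),
      Finset.sum_filter]
    simp only [ite_and]
  rw [weight]
  split_ifs with hk
  · have : ∀ i, ¬ (i < k ∧ OnComponent (π.center i) (π.center k)) := fun i hi => by
      simpa [hk] using hi.2.length_lt
    simp [this]
  · rw [← hsum]
    push_cast
    simp

theorem det_proximity : π.proximity.det = 1 := by
  rw [Matrix.det_of_isLowerTriangular]
  · simp [proximity]
  · intro i k hik
    have hik' : i < k := hik
    simp [proximity, hik'.ne, hik'.not_gt]

theorem isUnit_proximity : IsUnit π.proximity := by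
  rw [Matrix.isUnit_iff_isUnit_det, det_proximity]
  exact isUnit_one

open scoped Classical in
-- The hypothesis on `w` is a rewriting of `F w = e_j`, and `F` is invertible.
theorem proximity_inv_apply_of_recursion (j : ι) (w : ι → ℤ)
    (hw : ∀ i, w i = (if i = j then 1 else 0) +
      ∑ k, if k < i ∧ OnComponent (π.center k) (π.center i) then w k else 0) (i : ι) :
    π.proximity⁻¹ i j = w i := by
  have key : π.proximity *ᵥ w = Pi.single j 1 := by
    ext i
    have hsplit : ∀ k, π.proximity i k * w k = (if i = k then w k else 0) -
        if k < i ∧ OnComponent (π.center k) (π.center i) then w k else 0 := by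
      intro k
      by_cases hik : i = k
      · subst hik
        simp [proximity]
      · by_cases h : k < i ∧ OnComponent (π.center k) (π.center i) <;>
          simp [proximity, hik, h]
    simp only [Matrix.mulVec, dotProduct, hsplit, Finset.sum_sub_distrib, Finset.sum_ite_eq,
      Finset.mem_univ, if_true]
    rw [hw i, add_sub_cancel_right, Pi.single_apply]
  have hdet : IsUnit π.proximity.det := (Matrix.isUnit_iff_isUnit_det _).1 π.isUnit_proximity
  have : w = π.proximity⁻¹ *ᵥ Pi.single j 1 := by
    rw [← key, Matrix.mulVec_mulVec, Matrix.nonsing_inv_mul _ hdet, Matrix.one_mulVec]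
  rw [this]
  simp

open scoped Classical in
theorem proximity_inv_apply_eq_dite (j i : ι) :
    π.proximity⁻¹ i j =
      if h : π.center j <:+ π.center i then ((π.sub j).weight ⟨i, h⟩ : ℤ) else 0 := by
  refine π.proximity_inv_apply_of_recursion j (fun i =>
    if h : π.center j <:+ π.center i then ((π.sub j).weight ⟨i, h⟩ : ℤ) else 0) (fun i => ?_) i
  by_cases h : π.center j <:+ π.center i
  · rw [dif_pos h, weight_eq]
    congr 1
    · simp only [sub_center_eq_nil_iff]
    · symm
      rw [← Finset.sum_filter_of_ne (p := fun k => π.center j <:+ π.center k) (by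
        intro k _ hk
        by_contra hjk
        simp [hjk] at hk),
        Finset.sum_subtype (p := fun k => π.center j <:+ π.center k) _ (by simp)]
      refine Finset.sum_congr rfl fun k _ => ?_
      have hiff : OnComponent ((π.sub j).center k) ((π.sub j).center ⟨i, h⟩) ↔
          OnComponent (π.center k) (π.center i) := by
        rw [sub_onComponent_iff, sub_center_append]
      rw [dif_pos k.2]
      simp only [hiff]
      rfl
  -- If `center i` is not over `center j`, no component created over `center j` can pass through it,
  -- so every term of the recursion vanishes.
  · have hij : i ≠ j := by
      rintro rfl
      exact h (List.suffix_refl _)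
    rw [dif_neg h, if_neg hij, zero_add, eq_comm]
    refine Finset.sum_eq_zero fun k _ => ?_
    split_ifs with hk hjk
    · exact absurd (hjk.trans hk.2.suffix) h
    · rfl
    · rfl

theorem proximity_inv_apply_eq_weight {j : ι} (hj : π.center j = []) (i : ι) :
    π.proximity⁻¹ i j = (π.weight i : ℤ) := by
  classical
  refine π.proximity_inv_apply_of_recursion j (fun i => (π.weight i : ℤ)) (fun i => ?_) i
  have : π.center i = [] ↔ i = j := by rw [← hj, π.center_injective.eq_iff]
  rw [weight_eq]
  simp only [this]

end BlowUps

/-! ### Blow-up of a formal `1`-form -/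

open MvPowerSeries in
theorem coeff_X_pow_mul_eq_ite (a : Fin 2) (n : ℕ) (f : Series) (e : Fin 2 →₀ ℕ) :
    coeff e (X a ^ n * f) = if n ≤ e a then coeff (e - Finsupp.single a n) f else 0 := by
  rw [X_pow_eq, coeff_monomial_mul]
  simp

open MvPowerSeries in
theorem coeff_aeval_X (a b : Fin 2) (hab : a ≠ b) (p : Polynomial ℂ) (e : Fin 2 →₀ ℕ) :
    coeff e (Polynomial.aeval (X a : Series) p) = if e b = 0 then p.coeff (e a) else 0 := by
  induction p using Polynomial.induction_on' with
  | add p q hp hq =>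
    rw [map_add, map_add, hp, hq]
    split_ifs <;> simp
  | monomial n c =>
    have he : e = Finsupp.single a n ↔ e b = 0 ∧ n = e a := by
      constructor
      · rintro rfl
        simp [hab]
      · rintro ⟨h₁, h₂⟩
        ext k
        obtain rfl | rfl : k = a ∨ k = b := by omega
        · simp [h₂]
        · simp [hab, h₁]
    rw [Polynomial.aeval_monomial, MvPowerSeries.algebraMap_apply, coeff_C_mul, coeff_X_pow,
      Polynomial.coeff_monomial]
    simp only [he, ite_and]
    split_ifs <;> simp

theorem hasSubst_chart (d : Direction) : MvPowerSeries.HasSubst d.chart := by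
  refine MvPowerSeries.hasSubst_of_constantCoeff_zero fun s => ?_
  cases d <;> fin_cases s <;> simp [Direction.chart]

/-- The homogeneous part of degree `m` of a power series, restricted to the line `x = 1`. -/
def homogeneousPart (f : Series) (m : ℕ) : Polynomial ℂ :=
  ∑ b ∈ Finset.range (m + 1),
    Polynomial.monomial b (MvPowerSeries.coeff (Finsupp.single 0 (m - b) + Finsupp.single 1 b) f)

theorem eq_zero_of_homogeneousPart_eq_zero {f : Series} (h : ∀ m, homogeneousPart f m = 0) :
    f = 0 := by
  ext e
  have := congrArg (fun p => Polynomial.coeff p (e 1)) (h (e 0 + e 1))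
  simp only [homogeneousPart, Polynomial.finsetSum_coeff, Polynomial.coeff_monomial,
    Finset.sum_ite_eq', Polynomial.coeff_zero] at this
  have he : Finsupp.single 0 (e 0) + Finsupp.single 1 (e 1) = e := by
    ext k
    fin_cases k <;> simp
  rw [if_pos (by simp), Nat.add_sub_cancel, he] at this
  rw [map_zero, this]

open MvPowerSeries in
-- A form of degree `m` satisfies `f_m(x, x(t + c)) = x ^ m f_m(1, t + c)`, so each power of `x`
-- sees exactly one homogeneous part, shifted by `c`.
theorem coeff_subst_slope (c : ℂ) (f : Series) (e : Fin 2 →₀ ℕ) :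
    coeff e (subst (Direction.slope c).chart f) =
      (Polynomial.taylor c (homogeneousPart f (e 0))).coeff (e 1) := by
  have hterm : ∀ d : Fin 2 →₀ ℕ,
      coeff e (d.prod fun s k => (Direction.slope c).chart s ^ k) =
        if d 0 + d 1 = e 0 then (Polynomial.taylor c (Polynomial.X ^ d 1)).coeff (e 1) else 0 := by
    intro d
    have h₁ : (d.prod fun s k => (Direction.slope c).chart s ^ k) =
        X 0 ^ (d 0 + d 1) * Polynomial.aeval (X 1 : Series)
          ((Polynomial.X + Polynomial.C c) ^ d 1) := by
      rw [Finsupp.prod_fintype _ _ (by simp), Fin.prod_univ_two]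
      simp only [Direction.chart, Matrix.cons_val_zero, Matrix.cons_val_one, map_pow, map_add,
        Polynomial.aeval_X, Polynomial.aeval_C, MvPowerSeries.algebraMap_apply, mul_pow, pow_add, mul_assoc]
      rfl
    rw [h₁, coeff_X_pow_mul_eq_ite, coeff_aeval_X 1 0 (by decide), Polynomial.taylor_X_pow]
    simp only [Finsupp.coe_tsub, Pi.sub_apply, Finsupp.single_apply]
    simp only [if_true, zero_ne_one, if_false, Nat.sub_zero]
    split_ifs <;> first | rfl | omega
  rw [coeff_subst (hasSubst_chart _)]
  have hinj : Set.InjOn (fun b => Finsupp.single (0 : Fin 2) (e 0 - b) + Finsupp.single 1 b)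
      (Finset.range (e 0 + 1) : Set ℕ) := by
    intro b _ b' _ h
    simpa using DFunLike.congr_fun h 1
  rw [finsum_eq_sum_of_support_subset
    (s := (Finset.range (e 0 + 1)).image
      fun b => Finsupp.single (0 : Fin 2) (e 0 - b) + Finsupp.single 1 b), Finset.sum_image hinj]
  · simp only [hterm, homogeneousPart, map_sum, Polynomial.finsetSum_coeff]
    refine Finset.sum_congr rfl fun b hb => ?_
    have hb' : b ≤ e 0 := Nat.lt_succ_iff.1 (Finset.mem_range.1 hb)
    rw [← Polynomial.C_mul_X_pow_eq_monomial, Polynomial.taylor_mul, Polynomial.taylor_C,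
      Polynomial.coeff_C_mul]
    simp [hb']
  · intro d hd
    have h : d 0 + d 1 = e 0 := by
      by_contra h
      exact hd (by simp only [hterm, if_neg h, smul_zero])
    simp only [Finset.coe_image, Set.mem_image, Finset.mem_coe, Finset.mem_range]
    refine ⟨d 1, by omega, ?_⟩
    ext k
    fin_cases k
    · simp
      omega
    · simp

open MvPowerSeries in
-- The monomial `x ^ a y ^ b` becomes `s ^ a y ^ (a + b)`, and distinct monomials have distinct
-- images.
theorem coeff_subst_vertical (f : Series) (d : Fin 2 →₀ ℕ) :
    coeff (d + Finsupp.single 1 (d 0)) (subst Direction.vertical.chart f) = coeff d f := by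
  have hterm : ∀ d' : Fin 2 →₀ ℕ,
      coeff (d + Finsupp.single 1 (d 0)) (d'.prod fun s k => Direction.vertical.chart s ^ k) =
        if d' = d then 1 else 0 := by
    intro d'
    have h₁ : (d'.prod fun s k => Direction.vertical.chart s ^ k) =
        monomial (Finsupp.single 0 (d' 0) + Finsupp.single 1 (d' 0 + d' 1)) (1 : ℂ) := by
      rw [Finsupp.prod_fintype _ _ (by simp), Fin.prod_univ_two]
      simp only [Direction.chart, Matrix.cons_val_zero, Matrix.cons_val_one, mul_pow, X_pow_eq,
        monomial_mul_monomial, mul_one, add_assoc, ← Finsupp.single_add]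
    rw [h₁, coeff_monomial]
    refine if_congr ⟨fun h => ?_, ?_⟩ rfl rfl
    · have h0 := DFunLike.congr_fun h 0
      have h1 := DFunLike.congr_fun h 1
      simp at h0 h1
      ext k
      fin_cases k
      · exact h0.symm
      · change d' 1 = d 1
        omega
    · rintro rfl
      ext k
      fin_cases k
      · simp
      · simp [add_comm]
  rw [coeff_subst (hasSubst_chart _), finsum_eq_single _ d]
  · rw [hterm, if_pos rfl, smul_eq_mul, mul_one]
  · intro d' hd'
    rw [hterm, if_neg hd', smul_zero]

theorem eq_zero_of_subst_chart_eq_zero {d : Direction} {f : Series}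
    (h : MvPowerSeries.subst d.chart f = 0) : f = 0 := by
  cases d with
  | slope c =>
    refine eq_zero_of_homogeneousPart_eq_zero fun m => (Polynomial.taylor_eq_zero c _).1 ?_
    ext l
    have := coeff_subst_slope c f (Finsupp.single 0 m + Finsupp.single 1 l)
    rw [h] at this
    simpa using this.symm
  | vertical =>
    ext e
    rw [← coeff_subst_vertical, h]
    simp

namespace OneForm

theorem pullback_slope_P (c : ℂ) (ω : OneForm) :
    (pullback (Direction.slope c).chart ω).P = MvPowerSeries.subst (Direction.slope c).chart ω.P +
      MvPowerSeries.subst (Direction.slope c).chart ω.Q *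
        (MvPowerSeries.X 1 + MvPowerSeries.C c) := by
  have h : MvPowerSeries.pderiv ℂ (0 : Fin 2) (MvPowerSeries.X 1 : Series) = 0 :=
    MvPowerSeries.pderiv_X_of_ne (by decide)
  simp [pullback, Direction.chart, h, MvPowerSeries.pderiv_X_self, Derivation.leibniz]

theorem pullback_slope_Q (c : ℂ) (ω : OneForm) :
    (pullback (Direction.slope c).chart ω).Q =
      MvPowerSeries.subst (Direction.slope c).chart ω.Q * MvPowerSeries.X 0 := by
  have h : MvPowerSeries.pderiv ℂ (1 : Fin 2) (MvPowerSeries.X 0 : Series) = 0 :=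
    MvPowerSeries.pderiv_X_of_ne (by decide)
  simp [pullback, Direction.chart, h, MvPowerSeries.pderiv_X_self, Derivation.leibniz]

theorem pullback_vertical_P (ω : OneForm) :
    (pullback Direction.vertical.chart ω).P =
      MvPowerSeries.subst Direction.vertical.chart ω.P * MvPowerSeries.X 1 := by
  have h : MvPowerSeries.pderiv ℂ (0 : Fin 2) (MvPowerSeries.X 1 : Series) = 0 :=
    MvPowerSeries.pderiv_X_of_ne (by decide)
  simp [pullback, Direction.chart, h, MvPowerSeries.pderiv_X_self, Derivation.leibniz]

theorem pullback_vertical_Q (ω : OneForm) :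
    (pullback Direction.vertical.chart ω).Q =
      MvPowerSeries.subst Direction.vertical.chart ω.P * MvPowerSeries.X 0 +
        MvPowerSeries.subst Direction.vertical.chart ω.Q := by
  have h : MvPowerSeries.pderiv ℂ (1 : Fin 2) (MvPowerSeries.X 0 : Series) = 0 :=
    MvPowerSeries.pderiv_X_of_ne (by decide)
  simp [pullback, Direction.chart, h, MvPowerSeries.pderiv_X_self, Derivation.leibniz]

/-- The pull-back is triangular in the two substituted coefficients, with a coordinate and `1` on
the diagonal, and substitution is injective. -/
theorem eq_zero_of_pullback_chart {d : Direction} {ω : OneForm} (hP : (pullback d.chart ω).P = 0)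
    (hQ : (pullback d.chart ω).Q = 0) : ω.P = 0 ∧ ω.Q = 0 := by
  have hX : ∀ a : Fin 2, (MvPowerSeries.X a : Series) ≠ 0 := fun a h => by
    simpa using congrArg (MvPowerSeries.coeff (Finsupp.single a 1)) h
  cases d with
  | slope c =>
    rw [pullback_slope_Q] at hQ
    have hQ' := (mul_eq_zero.1 hQ).resolve_right (hX 0)
    rw [pullback_slope_P, hQ', zero_mul, add_zero] at hP
    exact ⟨eq_zero_of_subst_chart_eq_zero hP, eq_zero_of_subst_chart_eq_zero hQ'⟩
  | vertical =>
    rw [pullback_vertical_P] at hP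
    have hP' := (mul_eq_zero.1 hP).resolve_right (hX 1)
    rw [pullback_vertical_Q, hP', zero_mul, zero_add] at hQ
    exact ⟨eq_zero_of_subst_chart_eq_zero hP', eq_zero_of_subst_chart_eq_zero hQ⟩

/-- `toNat` can only lower the minimum (it sends `⊤` to `0`), so divisibility holds even for the
zero form. -/
theorem X_pow_orderAlong_dvd (a : Fin 2) (ω : OneForm) :
    (MvPowerSeries.X a : Series) ^ orderAlong a ω ∣ ω.P ∧
      (MvPowerSeries.X a : Series) ^ orderAlong a ω ∣ ω.Q :=
  ⟨pow_dvd_of_le_emultiplicity ((ENat.natCast_toNat_le_self _).trans (min_le_left _ _)),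
    pow_dvd_of_le_emultiplicity ((ENat.natCast_toNat_le_self _).trans (min_le_right _ _))⟩

theorem coeff_divXPow (a : Fin 2) (m : ℕ) (f : Series) (e : Fin 2 →₀ ℕ) :
    MvPowerSeries.coeff e (divXPow a m f) = MvPowerSeries.coeff (e + Finsupp.single a m) f :=
  rfl

theorem eq_zero_of_divXPow_eq_zero {a : Fin 2} {m : ℕ} {f : Series}
    (hd : (MvPowerSeries.X a : Series) ^ m ∣ f) (h : divXPow a m f = 0) : f = 0 := by
  ext e
  by_cases he : e a < m
  · simpa using MvPowerSeries.X_pow_dvd_iff.1 hd e he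
  · have : e = (e - Finsupp.single a m) + Finsupp.single a m := by
      rw [tsub_add_cancel_of_le]
      simpa using he
    rw [this, ← coeff_divXPow, h]
    simp

theorem eq_zero_of_saturate {a : Fin 2} {ω : OneForm} (hP : (saturate a ω).P = 0)
    (hQ : (saturate a ω).Q = 0) : ω.P = 0 ∧ ω.Q = 0 :=
  ⟨eq_zero_of_divXPow_eq_zero (X_pow_orderAlong_dvd a ω).1 hP,
    eq_zero_of_divXPow_eq_zero (X_pow_orderAlong_dvd a ω).2 hQ⟩

theorem orderAlong_eq {a : Fin 2} {ω : OneForm} {m : ℕ}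
    (h : (MvPowerSeries.X a : Series) ^ m ∣ ω.P ∧ (MvPowerSeries.X a : Series) ^ m ∣ ω.Q)
    (h' : ¬ ((MvPowerSeries.X a : Series) ^ (m + 1) ∣ ω.P ∧
      (MvPowerSeries.X a : Series) ^ (m + 1) ∣ ω.Q)) : orderAlong a ω = m := by
  rw [pow_dvd_iff_le_emultiplicity, pow_dvd_iff_le_emultiplicity, ← le_min_iff] at h h'
  have : min (emultiplicity (MvPowerSeries.X a) ω.P) (emultiplicity (MvPowerSeries.X a) ω.Q) =
      (m : ℕ∞) := by
    refine le_antisymm ?_ h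
    rw [not_le] at h'
    exact Order.le_of_lt_add_one (by simpa using h')
  rw [orderAlong, this, ENat.toNat_natCast]

theorem DefinesFoliation.ne_zero {ω : OneForm} (h : ω.DefinesFoliation) :
    ¬ (ω.P = 0 ∧ ω.Q = 0) := by
  rintro ⟨hP, hQ⟩
  have h0 : Convergent 0 := ⟨0, 0, by simp⟩
  exact not_isUnit_zero (h.2.2 0 0 0 h0 h0 h0 (by simp [hP]) (by simp [hQ]))

open MvPowerSeries in
theorem coeff_pullback_slope_P (c : ℂ) (ω : OneForm) (e : Fin 2 →₀ ℕ) :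
    coeff e (pullback (Direction.slope c).chart ω).P =
      (Polynomial.taylor c (homogeneousPart ω.P (e 0) +
        homogeneousPart ω.Q (e 0) * Polynomial.X)).coeff (e 1) := by
  rw [pullback_slope_P, map_add, map_add, Polynomial.coeff_add, coeff_subst_slope, mul_add,
    map_add, coeff_mul_C, coeff_subst_slope, Polynomial.taylor_mul, Polynomial.taylor_X, mul_add,
    Polynomial.coeff_add, Polynomial.coeff_mul_C, mul_comm _ (X 1), ← pow_one (X 1),
    coeff_X_pow_mul_eq_ite, coeff_subst_slope]
  congr 2
  cases h : e 1 with
  | zero => simp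
  | succ n => simp [h]

open MvPowerSeries in
theorem coeff_pullback_slope_Q (c : ℂ) (ω : OneForm) (e : Fin 2 →₀ ℕ) :
    coeff e (pullback (Direction.slope c).chart ω).Q =
      if 1 ≤ e 0 then (Polynomial.taylor c (homogeneousPart ω.Q (e 0 - 1))).coeff (e 1)
      else 0 := by
  rw [pullback_slope_Q, mul_comm, ← pow_one (X 0), coeff_X_pow_mul_eq_ite, coeff_subst_slope]
  simp

/-- Only finitely many points of the exceptional line of a blow-up are singular points of the
saturated pull-back. -/
theorem finite_singular_slope {ω : OneForm} (hω : ¬ (ω.P = 0 ∧ ω.Q = 0)) :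
    {c : ℂ | (saturate 0 (pullback (Direction.slope c).chart ω)).Singular}.Finite := by
  classical
  -- Up to the shift by `c`, `A m` and `B m` are the coefficients of `x ^ m` in the two components
  -- of the pull-back. The index shift in `B` comes from the factor `x` in `∂(x(t + c))/∂t`.
  set A : ℕ → Polynomial ℂ := fun m =>
    homogeneousPart ω.P m + homogeneousPart ω.Q m * Polynomial.X with hA
  set B : ℕ → Polynomial ℂ := fun m => if 1 ≤ m then homogeneousPart ω.Q (m - 1) else 0 with hB
  have hcA : ∀ c (e : Fin 2 →₀ ℕ), MvPowerSeries.coeff e (pullback (Direction.slope c).chart ω).P =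
      (Polynomial.taylor c (A (e 0))).coeff (e 1) := fun c e => coeff_pullback_slope_P c ω e
  have hcB : ∀ c (e : Fin 2 →₀ ℕ), MvPowerSeries.coeff e (pullback (Direction.slope c).chart ω).Q =
      (Polynomial.taylor c (B (e 0))).coeff (e 1) := fun c e => by
    rw [coeff_pullback_slope_Q]
    simp only [hB]
    split_ifs <;> simp
  have hex : ∃ m, ¬ (A m = 0 ∧ B m = 0) := by
    by_contra! h
    have hQ : ∀ m, homogeneousPart ω.Q m = 0 := fun m => by simpa [hB] using (h (m + 1)).2
    have hP : ∀ m, homogeneousPart ω.P m = 0 := fun m => by simpa [hA, hQ m] using (h m).1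
    exact hω ⟨eq_zero_of_homogeneousPart_eq_zero hP, eq_zero_of_homogeneousPart_eq_zero hQ⟩
  obtain ⟨N, hN, hmin⟩ : ∃ N, ¬ (A N = 0 ∧ B N = 0) ∧ ∀ m < N, A m = 0 ∧ B m = 0 :=
    ⟨Nat.find hex, Nat.find_spec hex, fun m hm => not_not.1 (Nat.find_min hex hm)⟩
  -- The Taylor shift is injective, so the order along the exceptional line does not depend on `c`.
  have hord : ∀ c, orderAlong 0 (pullback (Direction.slope c).chart ω) = N := by
    intro c
    refine orderAlong_eq ⟨?_, ?_⟩ fun h => hN ⟨?_, ?_⟩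
    · exact MvPowerSeries.X_pow_dvd_iff.2 fun e he => by rw [hcA, (hmin _ he).1]; simp
    · exact MvPowerSeries.X_pow_dvd_iff.2 fun e he => by rw [hcB, (hmin _ he).2]; simp
    · refine (Polynomial.taylor_eq_zero c _).1 (Polynomial.ext fun l => ?_)
      have := MvPowerSeries.X_pow_dvd_iff.1 h.1 (Finsupp.single 0 N + Finsupp.single 1 l) (by simp)
      rw [hcA] at this
      simpa using this
    · refine (Polynomial.taylor_eq_zero c _).1 (Polynomial.ext fun l => ?_)
      have := MvPowerSeries.X_pow_dvd_iff.1 h.2 (Finsupp.single 0 N + Finsupp.single 1 l) (by simp)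
      rw [hcB] at this
      simpa using this
  have hroot : ∀ c, (saturate 0 (pullback (Direction.slope c).chart ω)).Singular →
      (A N).IsRoot c ∧ (B N).IsRoot c := by
    rintro c ⟨h₁, h₂⟩
    rw [← MvPowerSeries.coeff_zero_eq_constantCoeff_apply] at h₁ h₂
    unfold saturate at h₁ h₂
    rw [coeff_divXPow, hord, hcA] at h₁
    rw [coeff_divXPow, hord, hcB] at h₂
    exact ⟨by simpa using h₁, by simpa using h₂⟩
  by_cases hAN : A N = 0
  · have hBN : B N ≠ 0 := fun h => hN ⟨hAN, h⟩
    exact (Polynomial.finite_setOfPred_isRoot hBN).subset fun c hc => (hroot c hc).2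
  · exact (Polynomial.finite_setOfPred_isRoot hAN).subset fun c hc => (hroot c hc).1

end OneForm

theorem transform_ne_zero {ω : OneForm} (hω : ¬ (ω.P = 0 ∧ ω.Q = 0)) (p : Point) :
    ¬ ((transform ω p).P = 0 ∧ (transform ω p).Q = 0) := by
  induction p with
  | nil => exact hω
  | cons d p ih =>
    rintro ⟨hP, hQ⟩
    obtain ⟨hP', hQ'⟩ := OneForm.eq_zero_of_saturate hP hQ
    exact ih (OneForm.eq_zero_of_pullback_chart hP' hQ')

theorem finite_singular_direction {ω : OneForm} (hω : ¬ (ω.P = 0 ∧ ω.Q = 0)) (p : Point) :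
    {d : Direction | (transform ω (d :: p)).Singular}.Finite := by
  refine (((OneForm.finite_singular_slope (transform_ne_zero hω p)).image Direction.slope).union
    (Set.finite_singleton Direction.vertical)).subset fun d hd => ?_
  cases d with
  | slope c => exact Or.inl ⟨c, hd, rfl⟩
  | vertical => exact Or.inr rfl

/-! ### Saddle-nodes -/

namespace OneForm

/-- For `f = X a`, the coefficient of `df ∧ ω` is, up to sign, the component `a` of the dual vector
field. -/
theorem IsSeparatrix.X_dvd_vectorField {ω : OneForm} {a : Fin 2}
    (h : ω.IsSeparatrix (MvPowerSeries.X a)) : MvPowerSeries.X a ∣ ω.vectorField a := by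
  have h10 : MvPowerSeries.pderiv ℂ (1 : Fin 2) (MvPowerSeries.X 0 : Series) = 0 :=
    MvPowerSeries.pderiv_X_of_ne (by decide)
  have h01 : MvPowerSeries.pderiv ℂ (0 : Fin 2) (MvPowerSeries.X 1 : Series) = 0 :=
    MvPowerSeries.pderiv_X_of_ne (by decide)
  have hd := h.2
  fin_cases a
  · simpa [wedge, vectorField, h10, MvPowerSeries.pderiv_X_self] using hd
  · simpa [wedge, vectorField, h01, MvPowerSeries.pderiv_X_self] using hd

theorem Singular.not_isTransverse {ω : OneForm} (h : ω.Singular) (f : Series) :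
    ¬ ω.IsTransverse f := by
  simp [IsTransverse, wedge, h.1, h.2]

theorem differential_X (b : Fin 2) (v : Fin 2 → ℂ) :
    differential (MvPowerSeries.X b) v = v b := by
  classical
  simp [differential, MvPowerSeries.pderiv_X, Pi.single_apply, apply_ite MvPowerSeries.constantCoeff]

/-- The multiplicity of a saddle-node along its strong separatrix is `1`. -/
theorem multiplicityAlong_strong_separatrix {ω : OneForm} {a b : Fin 2} (hab : a ≠ b)
    (hweak : ω.IsWeakSeparatrix (MvPowerSeries.X b))
    (hsep : ω.IsSeparatrix (MvPowerSeries.X a)) :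
    ω.multiplicityAlong (fun k => if k = a then 0 else PowerSeries.X) = 1 := by
  obtain ⟨⟨-, l, hroots, hl⟩, hsep', -, v, hv, hLv, hdv⟩ := hweak
  obtain ⟨h, hh⟩ := hsep'.X_dvd_vectorField
  obtain ⟨g, hg⟩ := hsep.X_dvd_vectorField
  rw [differential_X] at hdv
  have huniv : ∀ k : Fin 2, k = a ∨ k = b := fun k => by omega
  have hva : v a ≠ 0 := fun hva => hv (funext fun k => by
    rcases huniv k with rfl | rfl
    · exact hva
    · exact hdv)
  -- The kernel vector `v` is tangent to `X b = 0`, hence a multiple of the basis vector `a`. The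
  -- trace then identifies `h(0)` with the nonzero eigenvalue.
  have hLaa : ω.linearPart a a = 0 := by
    have h₁ : ∑ k, ω.linearPart a k * v k = 0 := congrFun hLv a
    rw [Fintype.sum_eq_single a fun k hk => by rw [(huniv k).resolve_left hk, hdv, mul_zero]] at h₁
    exact (mul_eq_zero.1 h₁).resolve_right hva
  have hLbb : ω.linearPart b b = MvPowerSeries.constantCoeff h := by
    simp [linearPart, hh, Derivation.leibniz, MvPowerSeries.pderiv_X_self]
  have htrace : ω.linearPart a a + ω.linearPart b b = l := by
    have h₁ := Matrix.trace_eq_sum_roots_charpoly ω.linearPart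
    rw [hroots, Matrix.trace, Fintype.sum_eq_add a b hab fun k hk =>
      absurd (huniv k) (by simpa using hk)] at h₁
    simpa using h₁
  have hh0 : MvPowerSeries.constantCoeff h ≠ 0 := by
    rw [← hLbb]
    rw [hLaa, zero_add] at htrace
    rwa [htrace]
  set γ : Fin 2 → PowerSeries ℂ := fun k => if k = a then 0 else PowerSeries.X with hγ
  have hγ0 : ∀ k, MvPowerSeries.constantCoeff (γ k) = 0 := fun k => by
    by_cases hk : k = a
    · simp [hγ, hk]
    · simp only [hγ, if_neg hk]
      exact PowerSeries.constantCoeff_X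
  have hS : MvPowerSeries.HasSubst γ := MvPowerSeries.hasSubst_of_constantCoeff_zero hγ0
  have hγa : γ a = 0 := by simp [hγ]
  have hγb : γ b = PowerSeries.X := by simp [hγ, hab.symm]
  have hsubst : PowerSeries.order (MvPowerSeries.subst γ h : PowerSeries ℂ) = 0 := by
    have h₁ : MvPowerSeries.constantCoeff
        (MvPowerSeries.subst γ (h - MvPowerSeries.C (MvPowerSeries.constantCoeff h))) = 0 :=
      MvPowerSeries.constantCoeff_subst_eq_zero hS hγ0 (by simp)
    rw [MvPowerSeries.subst_sub hS, MvPowerSeries.subst_C, map_sub, sub_eq_zero,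
      MvPowerSeries.constantCoeff_C] at h₁
    exact PowerSeries.order_zero_of_unit (PowerSeries.isUnit_iff_constantCoeff.2
      (isUnit_iff_ne_zero.2 (h₁.trans_ne hh0)))
  -- The equation in direction `b` forces `θ = t · h(γ(t))`, of order `1`; the one in direction `a`
  -- reads `0 = 0` by invariance. Nonemptiness matters, since `sInf ∅ = 0`.
  have hset : {m : ℕ | ∃ θ : PowerSeries ℂ,
      (∀ i, PowerSeries.derivative ℂ (γ i) * θ = MvPowerSeries.subst γ (ω.vectorField i)) ∧
      θ.order = (m : ℕ∞)} = {1} := by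
    have hb : (MvPowerSeries.subst γ (ω.vectorField b) : PowerSeries ℂ) =
        PowerSeries.X * MvPowerSeries.subst γ h := by
      rw [hh, MvPowerSeries.subst_mul hS, MvPowerSeries.subst_X hS, hγb]
    have hord : PowerSeries.order
        (PowerSeries.X * MvPowerSeries.subst γ h : PowerSeries ℂ) = 1 := by
      rw [PowerSeries.order_mul, hsubst, PowerSeries.order_X, add_zero]
    ext m
    constructor
    · rintro ⟨θ, h₁, h₂⟩
      have h₃ := h₁ b
      rw [hγb, PowerSeries.derivative_X, one_mul, hb] at h₃
      rw [h₃, hord] at h₂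
      exact_mod_cast h₂.symm
    · rintro rfl
      refine ⟨_, fun k => ?_, hord⟩
      rcases huniv k with rfl | rfl
      · rw [hγa, map_zero, zero_mul, hg, MvPowerSeries.subst_mul hS, MvPowerSeries.subst_X hS, hγa,
          zero_mul]
      · rw [hγb, PowerSeries.derivative_X, one_mul, hb]
  rw [multiplicityAlong, hset, csInf_singleton]

end OneForm

/-! ### Tangency excess -/

namespace BlowUps

variable {ι : Type} [LinearOrder ι] [Fintype ι] (π : BlowUps ι)

theorem finite_tangentSaddleNodes {ω : OneForm} (hω : ¬ (ω.P = 0 ∧ ω.Q = 0)) :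
    (π.tangentSaddleNodes ω).Finite := by
  refine ((Set.finite_range π.center).biUnion fun p _ =>
    (finite_singular_direction hω p).image (· :: p)).subset ?_
  rintro q ⟨hq, hsn, i, hi, -⟩
  cases q with
  | nil => simpa using hi.length_lt
  | cons d p => exact Set.mem_biUnion (hq.2 d p rfl) ⟨d, hsn.1, rfl⟩

/-- Interchange of summation over points and components. -/
theorem tangencyExcess_eq_sum {ω : OneForm} (h : (π.tangentSaddleNodes ω).Finite) :
    π.tangencyExcess ω = ∑ i, (π.weight i : ℤ) * π.saddleNodeVector ω i := by
  classical
  rw [tangencyExcess, finsum_mem_eq_finite_toFinset_sum _ h, Finset.sum_comm]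
  refine Finset.sum_congr rfl fun i _ => ?_
  rw [saddleNodeVector, finsum_mem_eq_finite_toFinset_sum _ (h.inter_of_left _), Finset.mul_sum,
    ← Finset.sum_filter]
  refine Finset.sum_congr ?_ fun _ _ => rfl
  ext q
  simp

/-- Only this inclusion is automatic: for the converse, the component containing the weak separatrix
may have been created before `center j` was blown up. -/
theorem append_mem_tangentSaddleNodes {ω : OneForm} {j : ι} {r : Point}
    (h : r ∈ (π.sub j).tangentSaddleNodes (transform ω (π.center j))) :
    r ++ π.center j ∈ π.tangentSaddleNodes ω := by
  obtain ⟨h₁, h₂, k, hk, hw⟩ := h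
  rw [← transform_append] at h₂ hw
  rw [sub_componentEq] at hw
  exact ⟨(π.mem_sub_points_iff j r).1 h₁, h₂, k, (π.sub_onComponent_iff j k r).1 hk, hw⟩

/-- A singular point admits no transverse component, so the reduction hypothesis makes the second
component invariant; lying on the other axis, it is the strong separatrix. -/
theorem componentMultiplicity_eq_one {ω : OneForm} (hπ : π.IsReduction ω) {q : Point}
    (hq : q ∈ π.points) {i k : ι} (hik : i ≠ k) (hi : OnComponent (π.center i) q)
    (hk : OnComponent (π.center k) q)
    (hw : (transform ω q).IsWeakSeparatrix (componentEq (π.center k) q)) :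
    π.componentMultiplicity ω q i = 1 := by
  have hsep := ((hπ q hq).2.1 i hi).resolve_right (hw.1.1.not_isTransverse _)
  refine OneForm.multiplicityAlong_strong_separatrix (fun h => hik ?_) hw hsep
  have h₁ := axis_componentAxis hi
  rw [h, axis_componentAxis hk] at h₁
  exact (π.center_injective (Option.some_injective _ h₁)).symm

theorem sub_saddleNodeVector {ω : OneForm} (hπ : π.IsReduction ω) (j : ι)
    (i : {i : ι // π.center j <:+ π.center i}) :
    (π.sub j).saddleNodeVector (transform ω (π.center j)) i = π.saddleNodeVector ω i := by
  have hinj : Function.Injective fun r : Point => r ++ π.center j :=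
    fun _ _ h => List.append_cancel_right h
  unfold saddleNodeVector
  simp only [sub_componentMultiplicity]
  rw [← finsum_mem_image (f := fun q => (π.componentMultiplicity ω q i : ℤ) - 1) hinj.injOn]
  refine finsum_mem_inter_support_eq' _ _ _ fun q hq => ⟨?_, ?_⟩
  · rintro ⟨r, ⟨h₁, h₂⟩, rfl⟩
    exact ⟨π.append_mem_tangentSaddleNodes h₁, (π.sub_onComponent_iff j i r).1 h₂⟩
  · rintro ⟨⟨h₁, h₂, k, hk, hw⟩, hi⟩
    obtain ⟨r, rfl⟩ := i.2.trans (OnComponent.suffix hi)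
    -- If the weak separatrix lay in a component not created over `center j`, the summand at `q`
    -- would vanish, against `q` being in the support.
    have hjk : π.center j <:+ π.center k := by
      by_contra hjk
      refine hq ?_
      have hik : i.1 ≠ k := by
        rintro rfl
        exact hjk i.2
      simp [π.componentMultiplicity_eq_one hπ h₁ hik hi hk hw]
    refine ⟨r, ⟨⟨(π.mem_sub_points_iff j r).2 h₁, ?_, ⟨k, hjk⟩,
      (π.sub_onComponent_iff j ⟨k, hjk⟩ r).2 hk, ?_⟩, (π.sub_onComponent_iff j i r).2 hi⟩, rfl⟩
    · rwa [← transform_append]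
    · rwa [← transform_append, sub_componentEq]

theorem tangencyExcessVector_eq_sum {ω : OneForm} (hω : ¬ (ω.P = 0 ∧ ω.Q = 0))
    (hπ : π.IsReduction ω) (j : ι) :
    π.tangencyExcessVector ω j = ∑ i, π.proximity⁻¹ i j * π.saddleNodeVector ω i := by
  classical
  rw [tangencyExcessVector,
    tangencyExcess_eq_sum _ ((π.sub j).finite_tangentSaddleNodes (transform_ne_zero hω _)),
    ← Finset.sum_filter_of_ne (p := fun i => π.center j <:+ π.center i) (by
      intro i _ hi
      by_contra hji
      simp [proximity_inv_apply_eq_dite, hji] at hi),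
    Finset.sum_subtype (p := fun i => π.center j <:+ π.center i) _ (by simp)]
  refine Finset.sum_congr rfl fun i _ => ?_
  rw [π.sub_saddleNodeVector hπ, proximity_inv_apply_eq_dite, dif_pos i.2]

theorem center_eq_nil {j : ι} (hj : ∀ i, j ≤ i) : π.center j = [] := by
  cases h : π.center j with
  | nil => rfl
  | cons d p =>
    obtain ⟨i, hi, -⟩ := (π.center_mem j).2 d p h
    exact absurd hi (hj i).not_gt

end BlowUps

end PlaneFoliation

end

theorem proposition2 (n : ℕ) (hn : 0 < n) (ω : PlaneFoliation.OneForm)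
    (hω : ω.DefinesFoliation) (π : PlaneFoliation.BlowUps (Fin n)) (hπ : π.IsReduction ω) :
    -- the sub-compositions over the centres are reductions of singularities there,
    -- and all the sums below are finite
    (∀ j, (π.sub j).IsReduction (PlaneFoliation.transform ω (π.center j))) ∧
    (π.tangentSaddleNodes ω).Finite ∧
    (∀ j, ((π.sub j).tangentSaddleNodes
      (PlaneFoliation.transform ω (π.center j))).Finite) ∧
    -- the first entry of the tangency excess vector is the tangency excess of the germ itself
    π.tangencyExcessVector ω ⟨0, hn⟩ = π.tangencyExcess ω ∧
    -- the identity of vectors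
    IsUnit π.proximity ∧
    (π.proximity⁻¹)ᵀ *ᵥ π.saddleNodeVector ω = π.tangencyExcessVector ω ∧
    -- the columns of the inverse of the proximity matrix
    (∀ i, π.proximity⁻¹ i ⟨0, hn⟩ = (π.weight i : ℤ)) ∧
    (∀ j i, (∀ h : π.center j <:+ π.center i,
        π.proximity⁻¹ i j = ((π.sub j).weight ⟨i, h⟩ : ℤ)) ∧
      (¬ π.center j <:+ π.center i → π.proximity⁻¹ i j = 0)) := by
  have h0 := hω.ne_zero
  have hfin := π.finite_tangentSaddleNodes h0
  have hcol := π.proximity_inv_apply_eq_weight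
    (π.center_eq_nil (j := ⟨0, hn⟩) fun i => Nat.zero_le i)
  refine ⟨hπ.sub, hfin,
    fun j => (π.sub j).finite_tangentSaddleNodes (PlaneFoliation.transform_ne_zero h0 _), ?_,
    π.isUnit_proximity, funext fun j => (π.tangencyExcessVector_eq_sum h0 hπ j).symm, hcol,
    fun j i => ⟨fun h => ?_, fun h => ?_⟩⟩
  -- `π.sub` at the first index has a different index type from `π`, so the two excesses are
  -- compared through their weighted sums.
  · simp only [π.tangencyExcessVector_eq_sum h0 hπ, π.tangencyExcess_eq_sum hfin, hcol]
  · rw [π.proximity_inv_apply_eq_dite, dif_pos h]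
  · rw [π.proximity_inv_apply_eq_dite, dif_neg h]
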